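/- A system $(X,T)$ is a compact metric space $(X,\rho)$ with a homeomorphism $T\colon X\to X$; it is countable if $X$ is a countable set. For ordinals define the derived sets by $X^{(0)}=X$, $X^{(\beta+1)}=$ the set of accumulation points of $X^{(\beta)}$, and $X^{(\lambda)}=\bigcap_{\beta<\lambda}X^{(\beta)}$ for $\lambda$ a limit. Write $d(X)=\alpha$ if $X^{(\alpha)}\ne\emptyset$ and $X^{(\alpha+1)}=\emptyset$. For a closed set $A\subseteq X$ with $T(A)=A$ let $\Omega(A,T)$ be the set of $x\in A$ such that for every neighbourhood $U$ of $x$ in $A$ there is $k\ge1$ with $U\cap T^{-k}U\neq\emptyset$, and let $\Omega^{(\infty)}(A,T)$ be the set of $x\in A$ such that for every neighbourhood $U$ of $x$ in $A$ and every $m\ge1$ there is $k\ge1$ with $U\cap T^{-k}U\cap T^{-2k}U\cap\dots\cap T^{-mk}U\ne\emptyset$. Put $\Omega_0(X,T)=X$, $\Omega_{\beta+1}(X,T)=\Omega(\Omega_\beta(X,T),T)$ and $\Omega_\lambda(X,T)=\bigcap_{\beta<\lambda}\Omega_\beta(X,T)$ for $\lambda$ a limit, and let $\mathrm{depth}(X,T)$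 be the least $\beta$ with $\Omega_\beta(X,T)=\Omega_{\beta+1}(X,T)$. Define $\Omega^{(\infty)}_\beta(X,T)$ and $\mathrm{depth}^{(\infty)}(X,T)$ (the van der Waerden depth) in the same way, with $\Omega^{(\infty)}$ in place of $\Omega$. For $\delta>0$ let $\Gamma_\delta[x]=\{y\in X: \rho(T^kx,T^ky)\le\delta\ \text{for all } k\in\mathbb Z\}$. The system is $n$-expansive if for some $\delta>0$ every $\Gamma_\delta[x]$ has at most $n$ elements. It is essentially $n$-expansive if it is $n$-expansive and for every sufficiently small $\delta>0$ there is an $x$ such that $\Gamma_\delta[x]$ has exactly $n$ elements (for $n\ge 2$, equivalently: it is $n$-expansive but not $(n-1)$-expansive). **Theorem.** Let $\alpha\ge 2$ be a countable ordinal that is not a limit ordinal and let $n\ge2$ be an integer. Then there is a countable system $(X_\alpha,T_\alpha)$ such that 1. $d(X_\alpha)=\mathrm{depth}^{(\infty)}(X_\alpha,T_\alpha)=\mathrm{depth}(X_\alpha,T_\alpha)=\alpha$, and 2. $(X_\alpha,T_\alpha)$ is essentially $n$-expansive. -/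

import Mathlib

open Set Topology Ordinal

/-- Transfinite iteration of an operator `F` on subsets of `X`, starting from the whole space:
`F_0 = X`, `F_{α+1} = F (F_α)`, and `F_λ = ⋂_{α<λ} F_α` for a limit ordinal `λ`. -/
noncomputable def transIter {X : Type} (F : Set X → Set X) (α : Ordinal.{0}) : Set X :=
  Ordinal.limitRecOn α Set.univ (fun _ A => F A) (fun o _ ih => ⋂ (β : Ordinal.{0}) (h : β < o), ih β h)

theorem transIter_zero {X : Type} (F : Set X → Set X) : transIter F 0 = Set.univ := by
  simp [transIter]

theorem transIter_add_one {X : Type} (F : Set X → Set X) (α : Ordinal.{0}) :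
    transIter F (α + 1) = F (transIter F α) := by
  simp [transIter]

theorem transIter_limit {X : Type} (F : Set X → Set X) (o : Ordinal.{0})
    (ho : Order.IsSuccLimit o) :
    transIter F o = ⋂ (β : Ordinal.{0}) (_ : β < o), transIter F β := by
  unfold transIter
  rw [Ordinal.limitRecOn_limit _ _ _ _ ho]

/-- The derived set `X^{(α)}` of order `α`. All the sets `X^{(α)}` are closed when `X` is metric, so that
the accumulation points of `X^{(α)}` in `X` are its accumulation points as a subspace. -/
noncomputable def derivedSetOrd (X : Type) [TopologicalSpace X] (α : Ordinal.{0}) : Set X :=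
  transIter derivedSet α

/-- `d(X) = α`: the derived degree of `X` is `α`. -/
def HasDerivedDegree (X : Type) [TopologicalSpace X] (α : Ordinal.{0}) : Prop :=
  (derivedSetOrd X α).Nonempty ∧ derivedSetOrd X (α + 1) = ∅

/-- The set `Ω(A, T)` of non-wandering points of the subsystem of `(X, T)` on `A`;
the neighbourhoods of `x` in the subspace `A` are, up to enlarging them, the sets `U ∩ A`. -/
def nonwanderingIn {X : Type} [TopologicalSpace X] (T : X → X) (A : Set X) : Set X :=
  {x ∈ A | ∀ U ∈ 𝓝 x, ∃ k : ℕ, 1 ≤ k ∧ ((U ∩ A) ∩ T^[k] ⁻¹' (U ∩ A)).Nonempty}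

/-- The set `Ω^{(∞)}(A, T)` of multi-non-wandering points of the subsystem of `(X, T)` on `A`. -/
def multiNonwanderingIn {X : Type} [TopologicalSpace X] (T : X → X) (A : Set X) : Set X :=
  {x ∈ A | ∀ U ∈ 𝓝 x, ∀ d : ℕ, 1 ≤ d → ∃ k : ℕ, 1 ≤ k ∧
    (⋂ j ∈ Finset.range (d + 1), T^[j * k] ⁻¹' (U ∩ A)).Nonempty}

/-- `depth(X, T) = α`: `α` is the least ordinal with `Ω_α(X, T) = Ω_{α+1}(X, T)`. -/
def HasDepth {X : Type} [TopologicalSpace X] (T : X → X) (α : Ordinal.{0}) : Prop :=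
  IsLeast {β : Ordinal.{0} |
    transIter (nonwanderingIn T) β = transIter (nonwanderingIn T) (β + 1)} α

/-- `depth^{(∞)}(X, T) = α`: the van der Waerden depth, the least ordinal `α` with
`Ω_α^{(∞)}(X, T) = Ω_{α+1}^{(∞)}(X, T)`. -/
def HasVdWDepth {X : Type} [TopologicalSpace X] (T : X → X) (α : Ordinal.{0}) : Prop :=
  IsLeast {β : Ordinal.{0} |
    transIter (multiNonwanderingIn T) β = transIter (multiNonwanderingIn T) (β + 1)} α

/-- `Γ_δ[x]`: the points whose full (two-sided) orbit stays within `δ` of that of `x`. -/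
def dynBall {X : Type} [MetricSpace X] (T : X ≃ₜ X) (δ : ℝ) (x : X) : Set X :=
  {y | ∀ k : ℤ, dist ((T ^ k : X ≃ₜ X) x) ((T ^ k : X ≃ₜ X) y) ≤ δ}

/-- `n`-expansiveness. -/
def IsNExpansive {X : Type} [MetricSpace X] (T : X ≃ₜ X) (n : ℕ) : Prop :=
  ∃ δ : ℝ, 0 < δ ∧ ∀ x : X, (dynBall T δ x).encard ≤ n

/-- Essential `n`-expansiveness: `n`-expansive, and for all small `δ > 0` some `Γ_δ[x]` has exactly
`n` points. (For `δ ≥ diam X` every `Γ_δ[x]` is all of `X`, so that `δ` has to be small.)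
For `n ≥ 1` this means `n`-expansive but not `(n-1)`-expansive, see below. -/
def IsEssentiallyNExpansive {X : Type} [MetricSpace X] (T : X ≃ₜ X) (n : ℕ) : Prop :=
  IsNExpansive T n ∧ ∃ δ₀ : ℝ, 0 < δ₀ ∧ ∀ δ : ℝ, 0 < δ → δ ≤ δ₀ →
    ∃ x : X, (dynBall T δ x).encard = n

theorem dynBall_mono {X : Type} [MetricSpace X] (T : X ≃ₜ X) {δ ε : ℝ} (h : δ ≤ ε) (x : X) :
    dynBall T δ x ⊆ dynBall T ε x :=
  fun _ hy k => (hy k).trans h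

theorem isEssentiallyNExpansive_iff {X : Type} [MetricSpace X] (T : X ≃ₜ X) (n : ℕ) :
    IsEssentiallyNExpansive T (n + 1) ↔ IsNExpansive T (n + 1) ∧ ¬ IsNExpansive T n := by
  constructor
  · rintro ⟨h1, δ₀, h0, h⟩
    refine ⟨h1, ?_⟩
    rintro ⟨ε, hε, hn⟩
    obtain ⟨x, hx⟩ := h (min ε δ₀) (lt_min hε h0) (min_le_right _ _)
    have h2 := (encard_le_encard (dynBall_mono T (min_le_left ε δ₀) x)).trans (hn x)
    rw [hx] at h2
    have h3 : n + 1 ≤ n := by exact_mod_cast h2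
    omega
  · rintro ⟨⟨δ₀, h0, h⟩, hn⟩
    refine ⟨⟨δ₀, h0, h⟩, δ₀, h0, fun δ hδ hle => ?_⟩
    by_contra! hne
    refine hn ⟨δ, hδ, fun x => ?_⟩
    have h2 := lt_of_le_of_ne
      ((encard_le_encard (dynBall_mono T hle x)).trans (h x)) (hne x)
    push_cast at h2
    exact ENat.lt_natCast_add_one_iff.1 h2

/-!
Suppose that every orbit of a compact system tends to one fixed point, and that its points carry
ordinal ranks such that near `x` all other points have smaller rank while, for every `γ` below the
rank of `x`, arbitrarily long arithmetic progressions in the orbit of some point of rank `γ` lie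
near `x`. Then the points of rank at least `γ` form both the `γ`-th derived set and the `γ`-th set
of either non-wandering filtration, so that the rank of the fixed point is the degree and both
depths.

Such systems are found among the `0`-`1` subshifts by recursion on the rank `β`: beside the zero
sequence and the sequences with a single one, take the sequences `x` of the systems of rank
`e k < β` superposed with their translates by `k, 2 * k, …, k * k`. Here `e` takes each value
below `β` infinitely often, and the ones of `x` are so far apart that the progressions do not
interlace; as `k → ∞`, the progressions are seen from each of their members as a single one.

Subshifts are expansive. Replacing each isolated point by `n` copies makes the system
`n`-expansive, since the dynamical balls lie in the fibres. The fibres of diameter at least `δ` are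
finite in number, and some orbit of isolated points misses all of them; hence there are dynamical
balls of radius `δ` with exactly `n` points.
-/

open Filter

section Iterates

variable {X Y : Type*} [TopologicalSpace X] [TopologicalSpace Y] {T : X ≃ₜ X} {S : Y ≃ₜ Y}
  {p : X → Y}

theorem semiconj_zpow (h : Function.Semiconj p T S) (k : ℤ) :
    Function.Semiconj p ⇑(T ^ k) ⇑(S ^ k) := by
  have hinv : Function.Semiconj p ⇑T⁻¹ ⇑S⁻¹ :=
    h.inverses_right T.apply_symm_apply S.symm_apply_apply
  induction k with
  | zero => exact .id_right
  | succ k ih =>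
    rw [zpow_add_one, zpow_add_one]
    exact ih.comp_right h
  | pred k ih =>
    rw [zpow_sub_one, zpow_sub_one]
    exact ih.comp_right hinv

theorem coe_zpow_natCast (T : X ≃ₜ X) (k : ℕ) : ⇑(T ^ (k : ℤ)) = T^[k] := by
  rw [zpow_natCast]
  exact hom_coe_pow _ rfl (fun _ _ => rfl) T k

end Iterates

theorem countable_of_eventually_lt {X ι : Type*} [TopologicalSpace X] [SecondCountableTopology X]
    [LinearOrder ι] [WellFoundedLT ι] {r : X → ι}
    (h : ∀ x, ∀ᶠ y in 𝓝[≠] x, r y < r x) : Countable X := by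
  obtain ⟨V, D, hV, hD, hVD⟩ := exists_countable_union_perfect_of_isClosed (isClosed_univ (X := X))
  obtain rfl | hne := D.eq_empty_or_nonempty
  · rwa [← countable_univ_iff, hVD, union_empty]
  have hmin := Function.argminOn_mem r D hne
  set x := Function.argminOn r D hne
  obtain ⟨U, hU, hUx⟩ := mem_nhdsWithin_iff_exists_mem_nhds_inter.1 (h x)
  obtain ⟨y, ⟨hyU, hyD⟩, hyx⟩ := preperfect_iff_nhds.1 hD.acc x hmin U hU
  exact absurd (hUx ⟨hyU, hyx⟩) (Function.not_lt_argminOn r D hyD)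

section TransfiniteIteration

variable {X : Type} {F : Set X → Set X} {r : X → Ordinal.{0}} {α : Ordinal.{0}}

theorem transIter_eq_setOf_le (hF : ∀ γ < α, F {x | γ ≤ r x} = {x | γ < r x}) {γ : Ordinal.{0}}
    (hγ : γ ≤ α) : transIter F γ = {x | γ ≤ r x} := by
  induction γ using WellFoundedLT.induction with
  | ind γ ih =>
    obtain rfl | ⟨β, rfl⟩ | hlim := zero_or_succ_or_isSuccLimit γ
    · simp only [transIter_zero, zero_le, ofPred_true]
    · rw [Order.succ_eq_add_one, transIter_add_one,
        ih β (Order.lt_succ β) ((Order.le_succ β).trans hγ), hF β (Order.succ_le_iff.1 hγ)]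
      simp only [Order.add_one_le_iff]
    · rw [transIter_limit F γ hlim, iInter₂_congr fun β hβ => ih β hβ (hβ.le.trans hγ)]
      ext x
      simp only [mem_iInter, mem_ofPred_eq]
      exact hlim.le_iff_forall_le.symm

theorem isLeast_transIter_eq (hF : ∀ γ < α, F {x | γ ≤ r x} = {x | γ < r x})
    (hα : F {x | α ≤ r x} = {x | α ≤ r x}) (hr : ∀ γ < α, ∃ x, r x = γ) :
    IsLeast {β | transIter F β = transIter F (β + 1)} α := by
  have hiter {γ : Ordinal.{0}} (hγ : γ ≤ α) := transIter_eq_setOf_le hF hγ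
  refine ⟨?_, fun β hβ => le_of_not_gt fun hlt => ?_⟩
  · rw [mem_ofPred_eq, transIter_add_one, hiter le_rfl, hα]
  · obtain ⟨x, rfl⟩ := hr β hlt
    rw [mem_ofPred_eq, hiter hlt.le, hiter (Order.add_one_le_of_lt hlt)] at hβ
    have hx : r x + 1 ≤ r x := hβ.subset (le_refl (r x))
    exact (Order.lt_add_one_iff.2 le_rfl).not_ge hx

end TransfiniteIteration

section Nonwandering

variable {X : Type} [TopologicalSpace X] {T : X → X} {A : Set X} {x : X}

theorem multiNonwanderingIn_subset_nonwanderingIn :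
    multiNonwanderingIn T A ⊆ nonwanderingIn T A := by
  rintro x ⟨hxA, hx⟩
  refine ⟨hxA, fun U hU => ?_⟩
  obtain ⟨k, hk, y, hy⟩ := hx U hU 1 le_rfl
  rw [mem_iInter₂] at hy
  refine ⟨k, hk, y, ?_, ?_⟩
  · simpa using hy 0 (by simp)
  · simpa using hy 1 (by simp)

theorem mem_multiNonwanderingIn_of_isFixedPt (hxA : x ∈ A) (hx : Function.IsFixedPt T x) :
    x ∈ multiNonwanderingIn T A := by
  refine ⟨hxA, fun U hU d _ => ⟨1, le_rfl, x, mem_iInter₂.2 fun j _ => ?_⟩⟩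
  rw [mem_preimage, hx.iterate]
  exact ⟨mem_of_mem_nhds hU, hxA⟩

end Nonwandering

/-- `r` ranks the points of the system `(X, T)`, in which all orbits tend to the fixed point `o`,
in such a way that a point is isolated among the points of at least its own rank, and a multiple
limit, in the sense of van der Waerden, of points of any given smaller rank. Then
`{x | γ ≤ r x}` is the `γ`-th derived set and the `γ`-th set of (multi-)non-wandering points. -/
structure IsRecurrenceRank {X : Type*} [TopologicalSpace X] (T : X ≃ₜ X) (r : X → Ordinal.{0})
    (o : X) : Prop where
  homoclinic : ∀ x, Tendsto (fun k : ℤ => (T ^ k) x) cofinite (𝓝 o)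
  rank_map : ∀ x, r (T x) = r x
  eventually_lt : ∀ x, ∀ᶠ y in 𝓝[≠] x, r y < r x
  recurrent : ∀ x, ∀ γ < r x, ∀ U ∈ 𝓝 x, ∀ d : ℕ, ∃ k ≥ 1, ∃ z, r z = γ ∧
    ∀ j ≤ d, T^[j * k] z ∈ U

namespace IsRecurrenceRank

section Orbits

variable {X : Type*} [TopologicalSpace X] {T : X ≃ₜ X} {r : X → Ordinal.{0}} {o x : X}
  (h : IsRecurrenceRank T r o)
include h

theorem rank_zpow (k : ℤ) (x : X) : r ((T ^ k) x) = r x := by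
  have hr : Function.Semiconj r T (1 : Ordinal.{0} ≃ₜ Ordinal.{0}) := h.rank_map
  rw [semiconj_zpow hr k x, one_zpow]
  rfl

theorem rank_iterate (k : ℕ) (x : X) : r (T^[k] x) = r x := by
  rw [← coe_zpow_natCast, h.rank_zpow]

theorem isFixedPt_zpow [T2Space X] (k : ℤ) : Function.IsFixedPt ⇑(T ^ k) o := by
  have hk : Tendsto (fun j : ℤ => (T ^ (k + j)) o) cofinite (𝓝 o) :=
    (h.homoclinic o).comp (add_right_injective k).tendsto_cofinite
  have hk' : Tendsto (fun j : ℤ => (T ^ k) ((T ^ j) o)) cofinite (𝓝 ((T ^ k) o)) :=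
    ((T ^ k).continuous.tendsto o).comp (h.homoclinic o)
  simp only [zpow_add, Homeomorph.mul_apply] at hk
  exact tendsto_nhds_unique hk' hk

theorem zpow_ne [T2Space X] (hx : x ≠ o) (k : ℤ) : (T ^ k) x ≠ o := by
  rw [← h.isFixedPt_zpow k]
  exact (T ^ k).injective.ne hx

theorem eq_of_isPeriodicPt [T1Space X] {k : ℕ} (hk : 1 ≤ k) (hx : Function.IsPeriodicPt T k x) :
    x = o := by
  have hinj : Function.Injective fun m : ℕ => ((m * k : ℕ) : ℤ) :=
    Nat.cast_injective.comp (mul_left_injective₀ (Nat.one_le_iff_ne_zero.1 hk))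
  have hlim := (h.homoclinic x).comp hinj.tendsto_cofinite
  have hconst : ((fun k : ℤ => (T ^ k) x) ∘ fun m : ℕ => ((m * k : ℕ) : ℤ)) = fun _ => x := by
    ext m
    rw [Function.comp_apply, coe_zpow_natCast]
    exact hx.const_mul m
  rwa [hconst, tendsto_const_nhds_iff] at hlim

theorem rank_lt [T2Space X] (hx : x ≠ o) : r x < r o := by
  obtain ⟨k, hk⟩ := ((h.homoclinic x).eventually
    (eventually_nhdsWithin_iff.1 (h.eventually_lt o))).exists
  rw [← h.rank_zpow k x]
  exact hk (h.zpow_ne hx k)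

theorem rank_le [T2Space X] (x : X) : r x ≤ r o := by
  obtain rfl | hx := eq_or_ne x o
  · exact le_rfl
  · exact (h.rank_lt hx).le

theorem exists_rank_eq {γ : Ordinal.{0}} (hγ : γ < r o) : ∃ x, r x = γ := by
  obtain ⟨_, _, x, hx, _⟩ := h.recurrent o γ hγ univ univ_mem 0
  exact ⟨x, hx⟩

theorem exists_rank_eq_zero_forall_zpow_notMem [T2Space X] (ho : 1 < r o) {F : Set X}
    (hF : F.Finite) (hF0 : ∀ y ∈ F, r y = 0) : ∃ y, r y = 0 ∧ ∀ k : ℤ, (T ^ k) y ∉ F := by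
  obtain ⟨z, hz⟩ := h.exists_rank_eq ho
  have hclosed : IsClosed (⋃ y ∈ F, insert o (range fun k : ℤ => (T ^ k) y)) :=
    hF.isClosed_biUnion fun y _ => (h.homoclinic y).isCompact_insert_range_of_cofinite.isClosed
  have hzF : z ∉ ⋃ y ∈ F, insert o (range fun k : ℤ => (T ^ k) y) := by
    simp only [mem_iUnion₂, mem_insert_iff, mem_range, not_exists]
    rintro y hy (rfl | ⟨k, rfl⟩)
    · exact ho.ne' hz
    · rw [h.rank_zpow, hF0 y hy] at hz
      exact zero_ne_one hz
  obtain ⟨_, _, y, hy, hyF⟩ :=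
    h.recurrent z 0 (hz ▸ zero_lt_one) _ (hclosed.isOpen_compl.mem_nhds hzF) 0
  refine ⟨y, hy, fun k hk => hyF 0 le_rfl (mem_iUnion₂.2 ⟨_, hk, Or.inr ⟨-k, ?_⟩⟩)⟩
  simp only [← Homeomorph.mul_apply, ← zpow_add, neg_add_cancel, zpow_zero, zero_mul,
    Function.iterate_zero]
  rfl

theorem setOf_rank_le_eq_singleton [T2Space X] : {x | r o ≤ r x} = {o} := by
  ext x
  refine ⟨fun hx => ?_, fun hx => hx ▸ le_refl (r x)⟩
  by_contra hne
  exact (h.rank_lt hne).not_ge hx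

end Orbits

section Depth

variable {X : Type} [TopologicalSpace X] {T : X ≃ₜ X} {r : X → Ordinal.{0}} {o : X}
  (h : IsRecurrenceRank T r o)
include h

theorem derivedSet_setOf_rank_le (γ : Ordinal.{0}) : derivedSet {x | γ ≤ r x} = {x | γ < r x} := by
  ext x
  rw [mem_derivedSet, accPt_iff_nhds]
  refine ⟨fun hx => ?_, fun hx U hU => ?_⟩
  · obtain ⟨y, ⟨hyU, hy : γ ≤ r y⟩, hyx⟩ := hx _ (eventually_nhdsWithin_iff.1 (h.eventually_lt x))
    exact hy.trans_lt (hyU hyx)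
  · obtain ⟨_, _, z, rfl, hzU⟩ := h.recurrent x γ hx U hU 0
    have hzU₀ := hzU 0 le_rfl
    rw [zero_mul, Function.iterate_zero_apply] at hzU₀
    exact ⟨z, ⟨hzU₀, le_refl (r z)⟩, fun hzx => (hzx ▸ hx : r z < r z).false⟩

theorem hasDerivedDegree [T2Space X] : HasDerivedDegree X (r o) := by
  have hiter (γ : Ordinal.{0}) : derivedSetOrd X γ = {x | γ ≤ r x} :=
    transIter_eq_setOf_le (fun β _ => h.derivedSet_setOf_rank_le β) le_rfl
  refine ⟨⟨o, (hiter _).ge (le_refl (r o))⟩, ?_⟩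
  rw [hiter]
  exact eq_empty_of_forall_notMem fun x hx =>
    (h.rank_le x).not_gt (Order.add_one_le_iff.1 hx)

theorem nonwanderingIn_subset [T2Space X] {γ : Ordinal.{0}} (hγ : γ < r o) :
    nonwanderingIn T {x | γ ≤ r x} ⊆ {x | γ < r x} := by
  rintro x ⟨hxγ : γ ≤ r x, hx⟩
  refine hxγ.lt_of_ne fun heq => ?_
  have hxo : x ≠ o := by
    rintro rfl
    exact hγ.ne heq
  obtain ⟨k, hk, y, ⟨hyU, hyγ : γ ≤ r y⟩, hTyU, hTyγ : γ ≤ r (T^[k] y)⟩ :=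
    hx _ (eventually_nhdsWithin_iff.1 (h.eventually_lt x))
  have heq_of {z : X} (hz : z ≠ x → r z < r x) (hzγ : γ ≤ r z) : z = x := by
    by_contra hne
    exact (heq ▸ hz hne).not_ge hzγ
  obtain rfl := heq_of hyU hyγ
  exact hxo (h.eq_of_isPeriodicPt hk (heq_of hTyU hTyγ))

theorem subset_multiNonwanderingIn (γ : Ordinal.{0}) :
    {x | γ < r x} ⊆ multiNonwanderingIn T {x | γ ≤ r x} := by
  refine fun x (hx : γ < r x) => ⟨hx.le, fun U hU d _ => ?_⟩
  obtain ⟨k, hk, z, hz, hzU⟩ := h.recurrent x γ hx U hU d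
  refine ⟨k, hk, z, mem_iInter₂.2 fun j hj => ⟨hzU j (Finset.mem_range_succ_iff.1 hj), ?_⟩⟩
  exact (hz.symm.trans (h.rank_iterate _ z).symm).le

theorem isLeast_depth [T2Space X] {F : Set X → Set X} (hF : ∀ A, F A ⊆ nonwanderingIn T A)
    (hF' : ∀ A, multiNonwanderingIn T A ⊆ F A) :
    IsLeast {β | transIter F β = transIter F (β + 1)} (r o) := by
  refine isLeast_transIter_eq (r := r) (fun γ hγ => ?_) ?_ fun γ hγ => h.exists_rank_eq hγ
  · exact ((hF _).trans (h.nonwanderingIn_subset hγ)).antisymm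
      ((h.subset_multiNonwanderingIn γ).trans (hF' _))
  · rw [h.setOf_rank_le_eq_singleton]
    refine ((hF _).trans (sep_subset _ _)).antisymm (singleton_subset_iff.2 (hF' _ ?_))
    exact mem_multiNonwanderingIn_of_isFixedPt rfl (h.isFixedPt_zpow 1)

theorem hasDepth [T2Space X] : HasDepth T (r o) :=
  h.isLeast_depth (fun _ => Subset.rfl) fun _ => multiNonwanderingIn_subset_nonwanderingIn

theorem hasVdWDepth [T2Space X] : HasVdWDepth T (r o) :=
  h.isLeast_depth (fun _ => multiNonwanderingIn_subset_nonwanderingIn) fun _ => Subset.rfl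

end Depth

end IsRecurrenceRank

section Factor

variable {X Y : Type} {p : X → Y}

theorem IsRecurrenceRank.comap [TopologicalSpace X] [CompactSpace X] [T1Space X]
    [TopologicalSpace Y] [T2Space Y] {T : X ≃ₜ X} {S : Y ≃ₜ Y} {r : Y → Ordinal.{0}} {o : Y}
    {σ : Y → X} (h : IsRecurrenceRank S r o) (hp : Continuous p) (hσ : Continuous σ)
    (hpT : Function.Semiconj p T S) (hσS : Function.Semiconj σ S T)
    (hpσ : Function.LeftInverse p σ) (hfin : ∀ y, (p ⁻¹' {y}).Finite) (ho : r o ≠ 0)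
    (hsec : ∀ x, r (p x) ≠ 0 → σ (p x) = x) : IsRecurrenceRank T (r ∘ p) (σ o) where
  homoclinic x := by
    refine le_nhds_of_unique_clusterPt fun x' hx' => ?_
    have hlim : Tendsto p (map (fun k : ℤ => (T ^ k) x) cofinite) (𝓝 o) := by
      rw [tendsto_map'_iff]
      simpa only [Function.comp_def, (semiconj_zpow hpT _).eq] using h.homoclinic (p x)
    have hpx' : p x' = o := eq_of_nhds_neBot ((hx'.map hp.continuousAt tendsto_map).mono hlim)
    rw [← hpx', hsec x' (hpx' ▸ ho)]
  rank_map x := (congrArg r (hpT x)).trans (h.rank_map (p x))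
  eventually_lt x := by
    have hfib : ∀ᶠ y in 𝓝 x, y ∉ p ⁻¹' {p x} \ {x} :=
      ((hfin (p x)).subset sdiff_subset).isClosed.isOpen_compl.mem_nhds fun hx => hx.2 rfl
    rw [eventually_nhdsWithin_iff]
    filter_upwards [hfib, hp.continuousAt (eventually_nhdsWithin_iff.1 (h.eventually_lt (p x)))]
      with y hy hlt hyx
    exact hlt fun hpy => hy ⟨hpy, hyx⟩
  recurrent x γ hγ U hU d := by
    rw [← hsec x (pos_of_gt hγ).ne'] at hU
    obtain ⟨k, hk, z, hz, hzU⟩ := h.recurrent (p x) γ hγ _ (hσ.continuousAt hU) d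
    refine ⟨k, hk, σ z, (congrArg r (hpσ z)).trans hz, fun j hj => ?_⟩
    rw [← (hσS.iterate_right _).eq]
    exact hzU j hj

variable [MetricSpace X] [CompactSpace X] [MetricSpace Y] {T : X ≃ₜ X} {S : Y ≃ₜ Y}

theorem exists_dynBall_subset_fiber (hp : Continuous p) (hpT : Function.Semiconj p T S)
    (hS : IsNExpansive S 1) : ∃ δ > 0, ∀ x, dynBall T δ x ⊆ p ⁻¹' {p x} := by
  obtain ⟨ε, hε, hS⟩ := hS
  obtain ⟨δ, hδ, hpδ⟩ :=
    Metric.uniformContinuous_iff_le.1 (CompactSpace.uniformContinuous_of_continuous hp) ε hε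
  refine ⟨δ, hδ, fun x x' hx' => ?_⟩
  have hmem : p x' ∈ dynBall S ε (p x) := fun k => by
    rw [← (semiconj_zpow hpT k).eq, ← (semiconj_zpow hpT k).eq]
    exact hpδ (hx' k)
  have hself : p x ∈ dynBall S ε (p x) := fun k => (dist_self _).trans_le hε.le
  exact encard_le_one_iff.1 (hS (p x)) _ _ hmem hself

theorem finite_setOf_le_dist_fiber {B : Set Y} (hp : Continuous p) (hB : ∀ y ∈ B, 𝓝[≠] y = ⊥)
    (hfib : ∀ y ∉ B, (p ⁻¹' {y}).Subsingleton) {δ : ℝ} (hδ : 0 < δ) :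
    {y ∈ B | ∃ x x', p x = y ∧ p x' = y ∧ δ ≤ dist x x'}.Finite := by
  have hclosed : IsClosed {q : X × X | p q.1 = p q.2 ∧ δ ≤ dist q.1 q.2} :=
    (isClosed_eq (hp.comp continuous_fst) (hp.comp continuous_snd)).inter
      (isClosed_le continuous_const continuous_dist)
  have himage : {y ∈ B | ∃ x x', p x = y ∧ p x' = y ∧ δ ≤ dist x x'} =
      (fun q : X × X => p q.1) '' {q | p q.1 = p q.2 ∧ δ ≤ dist q.1 q.2} := by
    ext y
    constructor
    · rintro ⟨-, x, x', rfl, hx', hxx'⟩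
      exact ⟨(x, x'), ⟨hx'.symm, hxx'⟩, rfl⟩
    · rintro ⟨⟨x, x'⟩, ⟨hx', hxx'⟩, rfl⟩
      refine ⟨?_, x, x', rfl, hx'.symm, hxx'⟩
      by_contra hxB
      rw [hfib _ hxB rfl hx'.symm, dist_self] at hxx'
      exact hδ.not_ge hxx'
  have hcompact := hclosed.isCompact.image (hp.comp continuous_fst)
  rw [himage]
  refine hcompact.finite (IsDiscrete.of_nhdsWithin fun y hy => ?_)
  have hyB : y ∈ B := (himage.ge hy).1
  have hpure : 𝓝 y = pure y :=
    (isOpen_singleton_iff_nhds_eq_pure y).1 ((isOpen_singleton_iff_punctured_nhds y).2 (hB y hyB))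
  exact nhdsWithin_le_nhds.trans hpure.le

theorem isEssentiallyNExpansive_of_factor {B : Set Y} {n : ℕ} (hn : n ≠ 0) (hp : Continuous p)
    (hpT : Function.Semiconj p T S) (hS : IsNExpansive S 1) (hB : ∀ y ∈ B, 𝓝[≠] y = ⊥)
    (hfib : ∀ y ∉ B, (p ⁻¹' {y}).Subsingleton) (hcard : ∀ y ∈ B, (p ⁻¹' {y}).encard = n)
    (horbit : ∀ F ⊆ B, F.Finite → ∃ y ∈ B, ∀ k : ℤ, (S ^ k) y ∉ F) :
    IsEssentiallyNExpansive T n := by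
  obtain ⟨δ₀, hδ₀, hsub⟩ := exists_dynBall_subset_fiber hp hpT hS
  refine ⟨⟨δ₀, hδ₀, fun x => (encard_le_encard (hsub x)).trans ?_⟩, δ₀, hδ₀, fun δ hδ hle => ?_⟩
  · by_cases hx : p x ∈ B
    · exact (hcard _ hx).le
    · exact (encard_le_one_iff_subsingleton.2 (hfib _ hx)).trans
        (Nat.one_le_cast.2 (Nat.one_le_iff_ne_zero.2 hn))
  · obtain ⟨y, hyB, hy⟩ :=
      horbit _ (sep_subset _ _) (finite_setOf_le_dist_fiber hp hB hfib hδ)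
    obtain ⟨x, rfl⟩ : (p ⁻¹' {y}).Nonempty := by
      rw [← encard_ne_zero, hcard y hyB]
      exact_mod_cast hn
    refine ⟨x, ?_⟩
    rw [← hcard _ hyB]
    refine congrArg encard (((dynBall_mono T hle x).trans (hsub x)).antisymm fun x' hx' k => ?_)
    by_contra! hlt
    have hk := (semiconj_zpow hpT k).eq x
    have hk' : p ((T ^ k) x') = (S ^ k) (p x) := ((semiconj_zpow hpT k).eq x').trans (by rw [hx'])
    refine hy k ⟨?_, _, _, hk, hk', hlt.le⟩
    by_contra hkB
    rw [hfib _ hkB hk hk', dist_self] at hlt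
    exact hδ.not_gt hlt

end Factor

section Blowup

variable {Y : Type} {B : Set Y} {n : ℕ} [NeZero n]

variable (B n) in
/-- The space `Y` with each point of `B` replaced by `n` copies of it; the copy with label `i` of
`y ∈ B` is encoded by the pair of `y` and the function that is `i` at `y` and `0` elsewhere. -/
def blowup : Set (Y × (Y → Fin n)) :=
  {q | ∀ z, q.2 z ≠ 0 → q.1 = z ∧ z ∈ B}

theorem zero_mem_blowup (y : Y) : (y, 0) ∈ blowup B n :=
  fun _ hz => absurd rfl hz

theorem snd_eq_zero_of_notMem {q : Y × (Y → Fin n)} (hq : q ∈ blowup B n) (hqB : q.1 ∉ B) :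
    q.2 = 0 := by
  ext1 z
  by_contra hz
  obtain ⟨rfl, hzB⟩ := hq z hz
  exact hqB hzB

theorem single_mem_blowup [DecidableEq Y] {y : Y} (hy : y ∈ B) (i : Fin n) :
    (y, Pi.single y i) ∈ blowup B n := fun z hz => by
  obtain rfl : z = y := by
    by_contra hzy
    exact hz (Pi.single_eq_of_ne (M := fun _ => Fin n) hzy i)
  exact ⟨rfl, hy⟩

theorem snd_eq_single [DecidableEq Y] {q : Y × (Y → Fin n)} (hq : q ∈ blowup B n) :
    q.2 = Pi.single q.1 (q.2 q.1) := by
  ext1 z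
  obtain rfl | hz := eq_or_ne z q.1
  · rw [Pi.single_eq_same]
  · rw [Pi.single_eq_of_ne hz]
    by_contra hqz
    exact hz (hq z hqz).1.symm

theorem encard_blowup_fiber {y : Y} (hy : y ∈ B) : {q : blowup B n | q.1.1 = y}.encard = n := by
  classical
  let copy (i : Fin n) : blowup B n := ⟨(y, Pi.single y i), single_mem_blowup hy i⟩
  have hcopy : Function.Injective copy := fun i j hij =>
    Pi.single_injective y (congrArg (fun q : blowup B n => q.1.2) hij)
  have hrange : {q : blowup B n | q.1.1 = y} = range copy := by
    ext q
    constructor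
    · rintro rfl
      exact ⟨q.1.2 q.1.1, Subtype.ext (Prod.ext rfl (snd_eq_single q.2).symm)⟩
    · rintro ⟨i, rfl⟩
      rfl
  rw [hrange, ← image_univ, hcopy.encard_image, encard_univ, ENat.card_eq_coe_fintype_card,
    Fintype.card_fin]

variable [TopologicalSpace Y]

theorem isClosed_blowup [T1Space Y] : IsClosed (blowup B n) := by
  have heq : blowup B n = ⋂ z, {q : Y × (Y → Fin n) | q.2 z ≠ 0 → q.1 = z ∧ z ∈ B} := by
    ext q
    rw [mem_iInter]
    rfl
  rw [heq]
  refine isClosed_iInter fun z => isClosed_imp ?_ ?_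
  · exact isOpen_compl_singleton.preimage ((continuous_apply z).comp continuous_snd)
  · exact (isClosed_singleton.preimage continuous_fst).and isClosed_const

/-- The homeomorphism of the blow-up that acts on `Y` as `S` and preserves the labels. -/
def blowupHomeomorph (S : Y ≃ₜ Y) (hS : ∀ y, S y ∈ B ↔ y ∈ B) : blowup B n ≃ₜ blowup B n :=
  (S.prodCongr (Homeomorph.piCongrLeft (Y := fun _ => Fin n) S.symm.toEquiv).symm).subtype
    fun q => by
      refine (forall_congr' fun z => ?_).trans S.surjective.forall.symm
      change _ ↔ (q.2 (S.symm (S z)) ≠ 0 → S q.1 = S z ∧ S z ∈ B)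
      rw [S.symm_apply_apply, hS, S.injective.eq_iff]

end Blowup

theorem IsRecurrenceRank.exists_isEssentiallyNExpansive {Y : Type} [MetricSpace Y] [CompactSpace Y]
    {S : Y ≃ₜ Y} {r : Y → Ordinal.{0}} {o : Y} (h : IsRecurrenceRank S r o)
    (hS : IsNExpansive S 1) (ho : 1 < r o) {n : ℕ} (hn : n ≠ 0) :
    ∃ (X : Type) (_ : MetricSpace X) (_ : CompactSpace X) (T : X ≃ₜ X) (r' : X → Ordinal.{0})
      (o' : X), r' o' = r o ∧ IsRecurrenceRank T r' o' ∧ IsEssentiallyNExpansive T n := by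
  have := NeZero.mk hn
  have : Countable Y := countable_of_eventually_lt h.eventually_lt
  set B : Set Y := {y | r y = 0}
  have : CompactSpace (blowup B n) := isCompact_iff_compactSpace.1 isClosed_blowup.isCompact
  let _ : MetricSpace (blowup B n) := TopologicalSpace.metrizableSpaceMetric _
  have hB : ∀ y, S y ∈ B ↔ y ∈ B := fun y => by rw [mem_ofPred_eq, h.rank_map]; rfl
  let T := blowupHomeomorph (n := n) S hB
  let p : blowup B n → Y := fun q => q.1.1
  let σ : Y → blowup B n := fun y => ⟨(y, 0), zero_mem_blowup y⟩
  have hp : Continuous p := continuous_fst.comp continuous_subtype_val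
  have hσ : Continuous σ := (continuous_id.prodMk continuous_const).subtype_mk _
  have hpT : Function.Semiconj p T S := fun _ => rfl
  have hσS : Function.Semiconj σ S T := fun _ => rfl
  have hσp {q : blowup B n} (hq : p q ∉ B) : σ (p q) = q :=
    Subtype.ext (Prod.ext rfl (snd_eq_zero_of_notMem q.2 hq).symm)
  have hfib : ∀ y ∉ B, (p ⁻¹' {y}).Subsingleton := by
    rintro _ hy q rfl q' hq'
    rw [← hσp hy, ← hσp (q := q') (hq'.symm ▸ hy), hq']
  have hcard : ∀ y ∈ B, (p ⁻¹' {y}).encard = n := fun y hy => encard_blowup_fiber hy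
  have hfin : ∀ y, (p ⁻¹' {y}).Finite := fun y => by
    by_cases hy : y ∈ B
    · exact finite_of_encard_eq_coe (hcard y hy)
    · exact (hfib y hy).finite
  have hisolated : ∀ y ∈ B, 𝓝[≠] y = ⊥ := fun y (hy : r y = 0) =>
    eventually_false_iff_eq_bot.1 ((h.eventually_lt y).mono fun z hz => not_lt_zero (hy ▸ hz))
  refine ⟨blowup B n, _, ‹_›, T, r ∘ p, σ o, rfl,
    h.comap hp hσ hpT hσS (fun _ => rfl) hfin (pos_of_gt ho).ne' fun q hq => hσp hq,
    isEssentiallyNExpansive_of_factor hn hp hpT hS hisolated hfib hcard fun F hFB hF => ?_⟩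
  exact h.exists_rank_eq_zero_forall_zpow_notMem ho hF hFB

theorem isNExpansive_one_of_generator {X A : Type} [MetricSpace X] [CompactSpace X]
    [TopologicalSpace A] [DiscreteTopology A] {T : X ≃ₜ X} {φ : X → A} (hφ : Continuous φ)
    (hgen : ∀ x y, (∀ k : ℤ, φ ((T ^ k) x) = φ ((T ^ k) y)) → x = y) : IsNExpansive T 1 := by
  have hopen : IsOpen {q : X × X | φ q.1 = φ q.2} :=
    (isOpen_discrete (diagonal A)).preimage (hφ.prodMap hφ)
  have hunif : {q : X × X | φ q.1 = φ q.2} ∈ uniformity X := by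
    rw [← nhdsSet_diagonal_eq_uniformity]
    exact hopen.mem_nhdsSet.2 fun q hq => congrArg φ hq
  obtain ⟨δ, hδ, hsub⟩ := Metric.mem_uniformity_dist.1 hunif
  refine ⟨δ / 2, half_pos hδ, fun x => encard_le_one_iff.2 fun y z hy hz => ?_⟩
  refine hgen y z fun k => ?_
  have hxy : φ ((T ^ k) x) = φ ((T ^ k) y) := hsub ((hy k).trans_lt (half_lt_self hδ))
  have hxz : φ ((T ^ k) x) = φ ((T ^ k) z) := hsub ((hz k).trans_lt (half_lt_self hδ))
  exact hxy.symm.trans hxz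

section Product

variable {ι A : Type*} [TopologicalSpace A]

theorem exists_finite_eqOn_subset {x : ι → A} {U : Set (ι → A)} (hU : U ∈ 𝓝 x) :
    ∃ I : Set ι, I.Finite ∧ ∀ y, EqOn y x I → y ∈ U := by
  rw [nhds_pi, Filter.mem_pi] at hU
  obtain ⟨I, hI, V, hV, hVU⟩ := hU
  exact ⟨I, hI, fun y hy => hVU fun i hi => hy hi ▸ mem_of_mem_nhds (hV i)⟩

theorem eventually_apply_eq [DiscreteTopology A] (x : ι → A) (i : ι) : ∀ᶠ y in 𝓝 x, y i = x i :=
  (continuous_apply i).continuousAt ((isOpen_discrete {x i}).mem_nhds rfl)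

end Product

section Shift

variable {A : Type*} [TopologicalSpace A]

variable (A) in
/-- The full two-sided shift on the alphabet `A`. -/
def shift : (ℤ → A) ≃ₜ (ℤ → A) :=
  (Homeomorph.piCongrLeft (Y := fun _ => A) (Equiv.addRight (1 : ℤ))).symm

theorem shift_apply (x : ℤ → A) (n : ℤ) : shift A x n = x (n + 1) :=
  rfl

theorem shift_zpow_apply (k : ℤ) (x : ℤ → A) (n : ℤ) : (shift A ^ k) x n = x (n + k) := by
  have hinv (x : ℤ → A) (n : ℤ) : (shift A)⁻¹ x n = x (n - 1) := by
    have h := congrFun ((shift A).apply_symm_apply x) (n - 1)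
    rwa [shift_apply, sub_add_cancel] at h
  induction k generalizing x with
  | zero => rw [zpow_zero, add_zero]; rfl
  | succ k ih => rw [zpow_add_one, Homeomorph.mul_apply, ih, shift_apply, add_assoc]
  | pred k ih => rw [zpow_sub_one, Homeomorph.mul_apply, ih, hinv, add_sub_assoc]

theorem shift_iterate_apply (k : ℕ) (x : ℤ → A) (n : ℤ) : (shift A)^[k] x n = x (n + k) := by
  rw [← coe_zpow_natCast, shift_zpow_apply]

theorem tendsto_shift_zpow {x : ℤ → A} {a : A} (hx : ∀ᶠ n in cofinite, x n = a) :
    Tendsto (fun k : ℤ => (shift A ^ k) x) cofinite (𝓝 fun _ => a) := by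
  refine tendsto_pi_nhds.2 fun n => tendsto_nhds_of_eventually_eq ?_
  simp only [shift_zpow_apply]
  exact (add_right_injective n).tendsto_cofinite.eventually hx

end Shift

section Spread

variable {N k : ℕ} {x y : ℤ → Bool} {a b n : ℤ}

/-- The sequence whose only one is at `a`. -/
def spike (a : ℤ) : ℤ → Bool :=
  fun n => decide (n = a)

/-- The superposition of the `k + 1` translates of `x` by `0, k, 2 * k, …, k * k`. -/
def spread (k : ℕ) (x : ℤ → Bool) : ℤ → Bool :=
  fun n => decide (∃ j ≤ k, x (n - j * k) = true)

/-- The inverse of `spread k` on widely spaced sequences: only the first one of each progression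
is kept. -/
def gather (k : ℕ) (x : ℤ → Bool) : ℤ → Bool :=
  fun n => x n && !x (n - k)

/-- Any two ones of `x` are at distance at least `N`. -/
def HasGap (N : ℕ) (x : ℤ → Bool) : Prop :=
  ∀ ⦃a b⦄, x a = true → x b = true → a < b → N ≤ b - a

theorem spike_eq_true : spike a n = true ↔ n = a :=
  decide_eq_true_iff

theorem spread_eq_true : spread k x n = true ↔ ∃ j ≤ k, x (n - j * k) = true :=
  decide_eq_true_iff

theorem spread_bot : spread k ⊥ = ⊥ := by
  ext n
  simp [spread]

theorem eq_bot_or_spike (h : ∀ a b, x a = true → x b = true → a = b) :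
    x = ⊥ ∨ ∃ a, x = spike a := by
  refine or_iff_not_imp_left.2 fun hx => ?_
  obtain ⟨a, ha⟩ := Function.ne_iff.1 hx
  rw [Pi.bot_apply, bot_eq_false, Bool.ne_false_iff] at ha
  refine ⟨a, funext fun n => Bool.eq_iff_iff.2 ?_⟩
  rw [spike_eq_true]
  exact ⟨fun hn => h n a hn ha, fun hn => hn ▸ ha⟩

theorem continuous_spread : Continuous (spread k) := by
  refine continuous_pi fun n => (continuous_bool_rng true).2 ?_
  have heq : (fun x => spread k x n) ⁻¹' {true} =
      ⋃ j ∈ Iic k, (fun x : ℤ → Bool => x (n - j * k)) ⁻¹' {true} := by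
    ext x
    simp only [mem_preimage, mem_singleton_iff, spread_eq_true, mem_iUnion₂, mem_Iic, exists_prop]
  rw [heq]
  exact (finite_Iic k).isClopen_biUnion fun j _ =>
    (isClopen_discrete {true}).preimage (continuous_apply _)

theorem continuous_gather : Continuous (gather k) :=
  continuous_pi fun n =>
    (continuous_of_discreteTopology (f := fun c : Bool × Bool => c.1 && !c.2)).comp
      ((continuous_apply n).prodMk (continuous_apply (n - k)) :
        Continuous fun x : ℤ → Bool => (x n, x (n - k)))

theorem semiconj_spread_shift :
    Function.Semiconj (spread k) (shift Bool) (shift Bool) := fun x => by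
  ext n
  simp only [shift_apply, spread, sub_add_eq_add_sub]

theorem HasGap.mono {M : ℕ} (h : HasGap N x) (hM : M ≤ N) : HasGap M x :=
  fun _ _ ha hb hab => (Int.ofNat_le.2 hM).trans (h ha hb hab)

theorem HasGap.eq_of_abs_lt (h : HasGap N x) (ha : x a = true) (hb : x b = true)
    (hab : |a - b| < N) : a = b := by
  rw [abs_lt] at hab
  obtain hlt | rfl | hlt := lt_trichotomy a b
  · exact absurd (h ha hb hlt) (by lia)
  · rfl
  · exact absurd (h hb ha hlt) (by lia)

protected theorem HasGap.spread (h : HasGap ((k + 2) * k) x) : HasGap k (spread k x) := by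
  intro a b ha hb hab
  obtain ⟨i, hi, hai⟩ := spread_eq_true.1 ha
  obtain ⟨j, hj, hbj⟩ := spread_eq_true.1 hb
  by_contra! hlt
  have hik : (i * k : ℤ) ≤ k * k := by gcongr
  have hjk : (j * k : ℤ) ≤ k * k := by gcongr
  have heq : a - i * k = b - j * k := by
    refine h.eq_of_abs_lt hai hbj (abs_lt.2 ⟨?_, ?_⟩) <;> push_cast <;> nlinarith
  have hdvd : (k : ℤ) ∣ b - a := ⟨j - i, by linear_combination -heq⟩
  exact hlt.not_ge (Int.le_of_dvd (sub_pos.2 hab) hdvd)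

theorem gather_spread (hk : 0 < k) (h : HasGap ((k + 2) * k) x) : gather k (spread k x) = x := by
  ext n
  rw [Bool.eq_iff_iff, gather, Bool.and_eq_true, Bool.not_eq_true', ← Bool.not_eq_true,
    spread_eq_true, spread_eq_true]
  constructor
  · rintro ⟨⟨_ | i, hi, hni⟩, hfirst⟩
    · simpa using hni
    · refine absurd ⟨i, (Nat.le_succ i).trans hi, ?_⟩ hfirst
      rwa [show n - k - i * k = n - (i + 1 : ℕ) * k by push_cast; ring]
  · refine fun hn => ⟨⟨0, zero_le, by simpa using hn⟩, ?_⟩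
    rintro ⟨j, hj, hnj⟩
    have hjk : (j * k : ℤ) ≤ k * k := by gcongr
    have heq : n = n - k - j * k := by
      refine h.eq_of_abs_lt hn hnj (abs_lt.2 ⟨?_, ?_⟩) <;> push_cast <;> nlinarith
    nlinarith

theorem exists_neighbor_of_spread (hk : 0 < k) (hn : spread k x n = true) :
    spread k x (n - k) = true ∨ spread k x (n + k) = true := by
  obtain ⟨_ | j, hj, hnj⟩ := spread_eq_true.1 hn
  · exact .inr (spread_eq_true.2 ⟨1, hk, by simpa using hnj⟩)
  · refine .inl (spread_eq_true.2 ⟨j, (Nat.le_succ j).trans hj, ?_⟩)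
    rwa [show n - k - j * k = n - (j + 1 : ℕ) * k by push_cast; ring]

theorem HasGap.eq_of_eqOn_spread {k' : ℕ} (hx : HasGap k x) (hk' : 0 < k') (hle : k' ≤ k)
    (ha : spread k' y a = true) (heq : EqOn (spread k' y) x (Icc (a - k) (a + k))) : k' = k := by
  refine hle.antisymm (Int.ofNat_le.1 ?_)
  have hxa : x a = true := (heq ⟨by lia, by lia⟩).symm.trans ha
  obtain hb | hb := exists_neighbor_of_spread hk' ha
  · have hgap := hx ((heq ⟨by lia, by lia⟩).symm.trans hb) hxa (by lia)
    lia
  · have hgap := hx hxa ((heq ⟨by lia, by lia⟩).symm.trans hb) (by lia)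
    lia

theorem finite_setOf_spread (hx : {n | x n = true}.Finite) :
    {n | spread k x n = true}.Finite := by
  have heq : {n | spread k x n = true} =
      ⋃ j ∈ Iic k, (fun n : ℤ => n - j * k) ⁻¹' {n | x n = true} := by
    ext n
    simp only [mem_ofPred_eq, spread_eq_true, mem_iUnion₂, mem_Iic, mem_preimage, exists_prop]
  rw [heq]
  exact (finite_Iic k).biUnion fun j _ => hx.preimage (sub_left_injective).injOn

end Spread

section Block

/-- `Block e β N x ρ`: the sequence `x` has rank `ρ ≤ β` in the system of rank `β` with ones more
than `N` apart. The points of rank `β` are the spikes; those of smaller rank are spread out from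
the points of the systems of ranks `e k < β`, whose gaps are long enough for the
progressions of step `k` not to interlace. -/
inductive Block (e : ℕ → Ordinal.{0}) : Ordinal.{0} → ℕ → (ℤ → Bool) → Ordinal.{0} → Prop
  | base {β : Ordinal.{0}} {N : ℕ} (a : ℤ) : Block e β N (spike a) β
  | step {β ρ : Ordinal.{0}} {N k : ℕ} {y : ℤ → Bool} (hk : N < k) (hβ : e k < β)
      (h : Block e (e k) ((k + 2) * k) y ρ) : Block e β N (spread k y) ρ

namespace Block

variable {e : ℕ → Ordinal.{0}} {β ρ : Ordinal.{0}} {N : ℕ} {x : ℤ → Bool}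

theorem rank_le (h : Block e β N x ρ) : ρ ≤ β := by
  induction h with
  | base _ => exact le_rfl
  | step _ hβ _ ih => exact ih.trans hβ.le

theorem exists_eq_true (h : Block e β N x ρ) : ∃ a, x a = true := by
  induction h with
  | base a => exact ⟨a, spike_eq_true.2 rfl⟩
  | step _ _ _ ih => exact ih.imp fun a ha => spread_eq_true.2 ⟨0, zero_le, by simpa using ha⟩

theorem ne_bot (h : Block e β N x ρ) : x ≠ ⊥ := by
  rintro rfl
  obtain ⟨_, ha⟩ := h.exists_eq_true
  exact Bool.false_ne_true ha

theorem hasGap (h : Block e β N x ρ) : HasGap N x := by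
  induction h with
  | base a =>
    intro b c hb hc hbc
    exact absurd ((spike_eq_true.1 hb).trans (spike_eq_true.1 hc).symm) hbc.ne
  | step hk _ _ ih => exact ih.spread.mono hk.le

theorem finite_setOf_eq_true (h : Block e β N x ρ) : {n | x n = true}.Finite := by
  induction h with
  | base a => exact (finite_singleton a).subset fun n hn => spike_eq_true.1 hn
  | step _ _ _ ih => exact finite_setOf_spread ih

theorem shift_zpow (h : Block e β N x ρ) (m : ℤ) : Block e β N ((shift Bool ^ m) x) ρ := by
  induction h with
  | base a =>
    convert Block.base (a - m) using 1
    ext n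
    rw [shift_zpow_apply, Bool.eq_iff_iff, spike_eq_true, spike_eq_true, eq_sub_iff_add_eq]
  | step hk hβ h ih =>
    rw [← (semiconj_zpow semiconj_spread_shift m).eq]
    exact .step hk hβ ih

theorem exists_eq_spread (h : Block e β N x ρ) {c d : ℤ} (hc : x c = true) (hd : x d = true)
    (hcd : c < d) : ∃ k y, N < k ∧ k ≤ d - c ∧ e k < β ∧ Block e (e k) ((k + 2) * k) y ρ ∧
      x = spread k y := by
  cases h with
  | base a => exact absurd ((spike_eq_true.1 hc).trans (spike_eq_true.1 hd).symm) hcd.ne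
  | step hk hβ h => exact ⟨_, _, hk, h.hasGap.spread hc hd hcd, hβ, h, rfl⟩

theorem eventually_rank_lt_or_eq (h : Block e β N x ρ) :
    ∀ᶠ x' in 𝓝 x, ∀ ρ', Block e β N x' ρ' → ρ' < ρ ∨ x' = x ∧ ρ' = ρ := by
  induction h with
  | base a =>
    filter_upwards [eventually_apply_eq (spike a) a] with x' hx' ρ' h'
    rw [spike_eq_true.2 rfl] at hx'
    cases h' with
    | base a' => exact .inr ⟨by rw [spike_eq_true.1 hx'], rfl⟩
    | step hk hβ h => exact .inl (h.rank_le.trans_lt hβ)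
  | @step β ρ N k y hk hβ h ih =>
    obtain ⟨c, hc⟩ := h.exists_eq_true
    have hk₀ : 0 < k := pos_of_gt hk
    have hgap := h.hasGap
    rw [← gather_spread hk₀ hgap] at ih
    -- A block that agrees with `spread k y` on this window is itself spread out with step `k`.
    have hwindow : ∀ᶠ x' in 𝓝 (spread k y),
        ∀ n ∈ Icc (c - k) (c + k), x' n = spread k y n :=
      (finite_Icc _ _).eventually_all.2 fun n _ => eventually_apply_eq _ n
    filter_upwards [hwindow, continuous_gather.continuousAt ih] with x' hx' hrank ρ' h'
    have hc₀ : x' c = true :=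
      (hx' c ⟨by lia, by lia⟩).trans (spread_eq_true.2 ⟨0, zero_le, by simpa⟩)
    have hc₁ : x' (c + k) = true :=
      (hx' (c + k) ⟨by lia, by lia⟩).trans (spread_eq_true.2 ⟨1, hk₀, by simpa⟩)
    obtain ⟨k', y', hk', hle, hβ', h'', rfl⟩ := h'.exists_eq_spread hc₀ hc₁ (by simpa using hk₀)
    rw [add_sub_cancel_left, Nat.cast_le] at hle
    obtain rfl : k' = k := hgap.spread.eq_of_eqOn_spread (pos_of_gt hk') hle hc₀ hx'
    rw [mem_preimage, gather_spread hk₀ h''.hasGap, gather_spread hk₀ hgap] at hrank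
    exact (hrank ρ' h'').imp_right (And.imp_left (congrArg _))

theorem rank_unique {ρ' : Ordinal.{0}} (h : Block e β N x ρ) (h' : Block e β N x ρ') :
    ρ' = ρ := by
  obtain hlt | ⟨-, heq⟩ := h.eventually_rank_lt_or_eq.self_of_nhds ρ' h'
  · obtain hgt | ⟨-, heq⟩ := h'.eventually_rank_lt_or_eq.self_of_nhds ρ h
    · exact absurd hlt hgt.not_gt
    · exact heq.symm
  · exact heq

theorem recurrent (he : ∀ γ < β, ∃ᶠ k in atTop, e k = γ) (h : Block e β N x ρ) {γ : Ordinal.{0}}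
    (hγ : γ < ρ) {U : Set (ℤ → Bool)} (hU : U ∈ 𝓝 x) (d : ℕ) :
    ∃ k ≥ 1, ∃ z, Block e β N z γ ∧ ∀ j ≤ d, (shift Bool)^[j * k] z ∈ U := by
  induction h generalizing U with
  | @base β N a =>
    obtain ⟨I, hI, hIU⟩ := exists_finite_eqOn_subset hU
    obtain ⟨M, hM⟩ := (hI.image fun n => (n - a).natAbs).bddAbove
    obtain ⟨k, hk, rfl⟩ := ((frequently_atTop.1 (he γ hγ)) (N + d + M + 1))
    refine ⟨k, by lia, _, .step (by lia) hγ (.base a), fun j hj => hIU _ fun n hn => ?_⟩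
    have hnM : (n - a).natAbs ≤ M := hM (mem_image_of_mem _ hn)
    have hnk : |n - a| < k := by
      rw [Int.abs_eq_natAbs]
      lia
    rw [shift_iterate_apply, Bool.eq_iff_iff, spread_eq_true, spike_eq_true]
    constructor
    · rintro ⟨i, _, hni⟩
      rw [spike_eq_true] at hni
      have hdvd : (k : ℤ) ∣ n - a := ⟨i - j, by push_cast at hni; linear_combination hni⟩
      exact sub_eq_zero.1 (Int.eq_zero_of_abs_lt_dvd hdvd hnk)
    · rintro rfl
      exact ⟨j, by lia, spike_eq_true.2 (by push_cast; ring)⟩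
  | step hk hβ _ ih =>
    obtain ⟨m, hm, z, hz, hzU⟩ := ih (fun γ hγ => he γ (hγ.trans hβ)) hγ
      (continuous_spread.continuousAt hU)
    refine ⟨m, hm, _, .step hk hβ hz, fun j hj => ?_⟩
    rw [← (semiconj_spread_shift.iterate_right _).eq]
    exact hzU j hj

end Block
end Block

section BlockSpace

variable (e : ℕ → Ordinal.{0}) (β : Ordinal.{0}) (N : ℕ)

/-- The countable subshift of all the blocks of rank at most `β` and the zero sequence. -/
def blockSpace : Set (ℤ → Bool) :=
  {x | x = ⊥ ∨ ∃ ρ, Block e β N x ρ}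

variable {e β N} {x : ℤ → Bool}

theorem shift_zpow_mem_blockSpace (hx : x ∈ blockSpace e β N) (m : ℤ) :
    (shift Bool ^ m) x ∈ blockSpace e β N := by
  obtain rfl | ⟨ρ, hρ⟩ := hx
  · refine .inl (funext fun n => ?_)
    rw [shift_zpow_apply]
    rfl
  · exact .inr ⟨ρ, hρ.shift_zpow m⟩

theorem spread_mem_blockSpace {k : ℕ} (hk : N < k) (hβ : e k < β)
    (hx : x ∈ blockSpace e (e k) ((k + 2) * k)) : spread k x ∈ blockSpace e β N := by
  obtain rfl | ⟨ρ, hρ⟩ := hx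
  · exact .inl spread_bot
  · exact .inr ⟨ρ, .step hk hβ hρ⟩

theorem isClosed_blockSpace : IsClosed (blockSpace e β N) := by
  induction β using WellFoundedLT.induction generalizing N with
  | ind β ih =>
    refine isClosed_of_closure_subset fun x hx => ?_
    by_cases hx₁ : ∀ a b, x a = true → x b = true → a = b
    · obtain rfl | ⟨a, rfl⟩ := eq_bot_or_spike hx₁
      · exact .inl rfl
      · exact .inr ⟨β, .base a⟩
    obtain ⟨c, d, hc, hd, hcd⟩ : ∃ c d, x c = true ∧ x d = true ∧ c < d := by
      push Not at hx₁
      obtain ⟨a, b, ha, hb, hab⟩ := hx₁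
      obtain hlt | hgt := hab.lt_or_gt
      · exact ⟨a, b, ha, hb, hlt⟩
      · exact ⟨b, a, hb, ha, hgt⟩
    let K : Set ℕ := {k | N < k ∧ k ≤ d - c ∧ e k < β}
    have hK : K.Finite := (finite_Iic (d - c).toNat).subset fun k hk => by
      rw [mem_Iic]
      have hkd := hk.2.1
      lia
    have hclosed : IsClosed (⋃ k ∈ K, spread k '' blockSpace e (e k) ((k + 2) * k)) :=
      hK.isClosed_biUnion fun k hk =>
        ((ih (e k) hk.2.2).isCompact.image continuous_spread).isClosed
    have hfreq : ∃ᶠ x' in 𝓝 x, x' ∈ ⋃ k ∈ K, spread k '' blockSpace e (e k) ((k + 2) * k) := by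
      refine ((mem_closure_iff_frequently.1 hx).and_eventually
        ((eventually_apply_eq x c).and (eventually_apply_eq x d))).mono ?_
      rintro x' ⟨rfl | ⟨ρ, h⟩, hx'c, hx'd⟩
      · exact absurd (hx'c.trans hc) Bool.false_ne_true
      · obtain ⟨k, y, hNk, hle, hβ, hy, rfl⟩ :=
          h.exists_eq_spread (hx'c.trans hc) (hx'd.trans hd) hcd
        exact mem_iUnion₂.2 ⟨k, ⟨hNk, hle, hβ⟩, y, .inr ⟨ρ, hy⟩, rfl⟩
    obtain ⟨k, hk, y, hy, rfl⟩ :=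
      mem_iUnion₂.1 (hclosed.mem_of_frequently_of_tendsto hfreq tendsto_id)
    exact spread_mem_blockSpace hk.1 hk.2.2 hy

variable (e β N)

/-- The shift on `blockSpace e β N`. -/
def blockShift : blockSpace e β N ≃ₜ blockSpace e β N :=
  (shift Bool).subtype fun x => by
    refine ⟨fun hx => shift_zpow_mem_blockSpace hx 1, fun hx => ?_⟩
    rw [← (shift Bool).symm_apply_apply x]
    exact shift_zpow_mem_blockSpace hx (-1)

open Classical in
/-- The rank of the points of `blockSpace e β N`: a block has the rank that its construction
assigns to it, and the zero sequence has rank `β + 1`. -/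
noncomputable def blockRank (x : ℤ → Bool) : Ordinal.{0} :=
  if h : ∃ ρ, Block e β N x ρ then h.choose else β + 1

variable {e β N}

theorem Block.blockRank_eq {ρ : Ordinal.{0}} (h : Block e β N x ρ) : blockRank e β N x = ρ := by
  have hex : ∃ ρ, Block e β N x ρ := ⟨ρ, h⟩
  rw [blockRank, dif_pos hex]
  exact h.rank_unique hex.choose_spec

theorem blockRank_bot : blockRank e β N ⊥ = β + 1 :=
  dif_neg fun ⟨_, h⟩ => h.ne_bot rfl

theorem semiconj_val_blockShift :
    Function.Semiconj Subtype.val (blockShift e β N) (shift Bool) :=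
  fun _ => rfl

theorem blockRank_shift (hx : x ∈ blockSpace e β N) :
    blockRank e β N (shift Bool x) = blockRank e β N x := by
  obtain rfl | ⟨ρ, h⟩ := hx
  · rfl
  · rw [h.blockRank_eq]
    exact (h.shift_zpow 1).blockRank_eq

theorem tendsto_shift_zpow_bot (hx : x ∈ blockSpace e β N) :
    Tendsto (fun k : ℤ => (shift Bool ^ k) x) cofinite (𝓝 ⊥) := by
  refine tendsto_shift_zpow ?_
  obtain rfl | ⟨ρ, h⟩ := hx
  · exact .of_forall fun _ => rfl
  · exact h.finite_setOf_eq_true.subset fun n hn => Bool.eq_true_of_not_eq_false hn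

theorem eventually_blockRank_lt (hx : x ∈ blockSpace e β N) :
    ∀ᶠ y in 𝓝 x, y ∈ blockSpace e β N → y ≠ x → blockRank e β N y < blockRank e β N x := by
  obtain rfl | ⟨ρ, h⟩ := hx
  · refine .of_forall fun y hy hne => ?_
    obtain ⟨ρ, h⟩ := hy.resolve_left hne
    rw [h.blockRank_eq, blockRank_bot]
    exact Order.lt_add_one_iff.2 h.rank_le
  · filter_upwards [h.eventually_rank_lt_or_eq, isOpen_compl_singleton.mem_nhds h.ne_bot]
      with y hrank hbot hy hne
    obtain ⟨ρ', h'⟩ := hy.resolve_left hbot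
    rw [h.blockRank_eq, h'.blockRank_eq]
    exact (hrank ρ' h').resolve_right fun heq => hne heq.1

theorem exists_block_of_rank_le (he : ∀ γ < β, ∃ᶠ k in atTop, e k = γ) {γ : Ordinal.{0}}
    (hγ : γ ≤ β) : ∃ x, Block e β N x γ := by
  obtain rfl | hlt := hγ.eq_or_lt
  · exact ⟨_, .base 0⟩
  · obtain ⟨_, _, z, hz, _⟩ := (Block.base 0).recurrent (N := N) he hlt univ_mem 0
    exact ⟨z, hz⟩

theorem blockSpace_recurrent (he : ∀ γ < β, ∃ᶠ k in atTop, e k = γ) (hx : x ∈ blockSpace e β N)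
    {γ : Ordinal.{0}} (hγ : γ < blockRank e β N x) {U : Set (ℤ → Bool)} (hU : U ∈ 𝓝 x) (d : ℕ) :
    ∃ k ≥ 1, ∃ z, Block e β N z γ ∧ ∀ j ≤ d, (shift Bool)^[j * k] z ∈ U := by
  obtain rfl | ⟨ρ, h⟩ := hx
  · rw [blockRank_bot, Order.lt_add_one_iff] at hγ
    obtain ⟨z, hz⟩ := exists_block_of_rank_le (N := N) he hγ
    have hev : ∀ᶠ m : ℤ in cofinite, ∀ j ∈ Iic d, (shift Bool ^ (j + m)) z ∈ U :=
      (finite_Iic d).eventually_all.2 fun j _ =>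
        (add_right_injective (j : ℤ)).tendsto_cofinite.eventually
          (tendsto_shift_zpow_bot (.inr ⟨γ, hz⟩) hU)
    obtain ⟨m, hm⟩ := hev.exists
    refine ⟨1, le_rfl, _, hz.shift_zpow m, fun j hj => ?_⟩
    rw [mul_one, ← coe_zpow_natCast, ← Homeomorph.mul_apply, ← zpow_add]
    exact hm j hj
  · rw [h.blockRank_eq] at hγ
    exact h.recurrent he hγ hU d

theorem isRecurrenceRank_blockShift (he : ∀ γ < β, ∃ᶠ k in atTop, e k = γ) :
    IsRecurrenceRank (blockShift e β N) (fun x => blockRank e β N x) ⟨⊥, .inl rfl⟩ where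
  homoclinic x := by
    refine tendsto_subtype_rng.2 ?_
    simp only [(semiconj_zpow semiconj_val_blockShift _).eq]
    exact tendsto_shift_zpow_bot x.2
  rank_map x := blockRank_shift x.2
  eventually_lt x := by
    rw [eventually_nhdsWithin_iff]
    filter_upwards [continuousAt_subtype_val (eventually_blockRank_lt x.2)] with y hy hyx
    exact hy y.2 (Subtype.coe_ne_coe.2 hyx)
  recurrent x γ hγ U hU d := by
    rw [nhds_subtype_eq_comap, mem_comap] at hU
    obtain ⟨V, hV, hVU⟩ := hU
    obtain ⟨k, hk, z, hz, hzV⟩ := blockSpace_recurrent he x.2 hγ hV d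
    refine ⟨k, hk, ⟨z, .inr ⟨γ, hz⟩⟩, hz.blockRank_eq, fun j hj => hVU ?_⟩
    rw [mem_preimage, (semiconj_val_blockShift.iterate_right _).eq]
    exact hzV j hj

theorem eq_of_blockShift_zpow_apply_zero {x y : blockSpace e β N}
    (h : ∀ k : ℤ, ((blockShift e β N ^ k) x).1 0 = ((blockShift e β N ^ k) y).1 0) : x = y := by
  refine Subtype.ext (funext fun n => ?_)
  have hn := h n
  simp only [(semiconj_zpow semiconj_val_blockShift n).eq, shift_zpow_apply, zero_add] at hn
  exact hn

end BlockSpace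

theorem exists_frequently_eq {β : Ordinal.{0}} (hβ : β < Ordinal.omega 1) :
    ∃ e : ℕ → Ordinal.{0}, ∀ γ < β, ∃ᶠ k in atTop, e k = γ := by
  have hcard : β.card ≤ Cardinal.aleph0 := by
    rwa [← Cardinal.ord_aleph, Cardinal.lt_ord, ← Cardinal.succ_aleph0, Order.lt_succ_iff] at hβ
  have hcount : (Iio β).Countable := by
    rwa [← Cardinal.le_aleph0_iff_set_countable, Cardinal.mk_Iio_ordinal, Cardinal.lift_le_aleph0]
  obtain ⟨f, hf⟩ := countable_iff_exists_subset_range.1 hcount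
  refine ⟨fun k => f k.unpair.1, fun γ hγ => frequently_atTop.2 fun M => ?_⟩
  obtain ⟨c, rfl⟩ := hf hγ
  exact ⟨Nat.pair c M, Nat.right_le_pair c M, congrArg (fun q => f q.1) (Nat.unpair_pair c M)⟩

theorem exists_expansive_isRecurrenceRank {β : Ordinal.{0}} (hβ : β < Ordinal.omega 1) :
    ∃ (Y : Type) (_ : MetricSpace Y) (_ : CompactSpace Y) (S : Y ≃ₜ Y) (r : Y → Ordinal.{0})
      (o : Y), r o = β + 1 ∧ IsRecurrenceRank S r o ∧ IsNExpansive S 1 := by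
  obtain ⟨e, he⟩ := exists_frequently_eq hβ
  have : CompactSpace (blockSpace e β 0) :=
    isCompact_iff_compactSpace.1 isClosed_blockSpace.isCompact
  let _ : MetricSpace (blockSpace e β 0) := TopologicalSpace.metrizableSpaceMetric _
  have hcont : Continuous fun x : blockSpace e β 0 => x.1 0 :=
    (continuous_apply 0).comp continuous_subtype_val
  exact ⟨blockSpace e β 0, _, ‹_›, blockShift e β 0, _, _, blockRank_bot,
    isRecurrenceRank_blockShift he,
    isNExpansive_one_of_generator hcont fun _ _ => eq_of_blockShift_zpow_apply_zero⟩

theorem theorem4p5_general (α : Ordinal.{0}) (hα : α < Ordinal.omega 1) (hα2 : 2 ≤ α)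
    (hlim : ¬ Order.IsSuccLimit α) (n : ℕ) (hn : n ≠ 0) :
    ∃ (X : Type) (_ : MetricSpace X) (_ : CompactSpace X) (_ : Countable X) (T : X ≃ₜ X),
      HasDerivedDegree X α ∧ HasVdWDepth T α ∧ HasDepth T α ∧ IsEssentiallyNExpansive T n := by
  have hα1 : 1 < α := (Order.lt_add_one_iff.2 le_rfl).trans_le (one_add_one_eq_two.trans_le hα2)
  obtain rfl | ⟨β, rfl⟩ | hα_lim := zero_or_succ_or_isSuccLimit α
  · exact absurd hα1 not_lt_zero
  · obtain ⟨Y, _, _, S, s, o, ho, hs, hS⟩ :=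
      exists_expansive_isRecurrenceRank ((Order.lt_succ β).trans hα)
    rw [Order.succ_eq_add_one, ← ho] at hα1 ⊢
    obtain ⟨X, _, _, T, r, o', ho', hr, hT⟩ := hs.exists_isEssentiallyNExpansive hS hα1 hn
    rw [← ho']
    exact ⟨X, _, ‹_›, countable_of_eventually_lt hr.eventually_lt, T, hr.hasDerivedDegree,
      hr.hasVdWDepth, hr.hasDepth, hT⟩
  · exact absurd hα_lim hlim

/-- For every countable ordinal `α ≥ 2` that is not a limit ordinal and every `n ≥ 2` there is a
countable compact metric system `(X, T)` with `d(X) = depth^{(∞)}(X, T) = depth(X, T) = α`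
that is essentially `n`-expansive. -/
theorem theorem4p5 (α : Ordinal.{0}) (hα : α < Ordinal.omega 1) (hα2 : 2 ≤ α)
    (hlim : ¬ Order.IsSuccLimit α) (n : ℕ) (hn : 2 ≤ n) :
    ∃ (X : Type) (_ : MetricSpace X) (_ : CompactSpace X) (_ : Countable X) (T : X ≃ₜ X),
      HasDerivedDegree X α ∧ HasVdWDepth T α ∧ HasDepth T α ∧ IsEssentiallyNExpansive T n :=
  theorem4p5_general α hα hα2 hlim n (by lia)
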